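/- Let $K$ be a field of characteristic zero, let $L/K$ be a finite extension with Galois closure $E/K$, and put $G=\mathrm{Gal}(E/K)$, $G_L=\mathrm{Gal}(E/L)$, $X=G/G_L$ (left cosets). Let $\lambda:G\to\mathrm{Perm}(X)$ be left translation. Let $N$ be a group and let $\alpha_1,\alpha_2:N\hookrightarrow\mathrm{Perm}(X)$ be injective homomorphisms whose images are regular (transitive on $X$ and of order $|X|$) and normalized by $\lambda(G)$. Let $G$ act on $\alpha_i(N)$ by $g\ast\eta=\lambda(g)\eta\lambda(g)^{-1}$, and let $E[\alpha_i(N)]^G$ be the $K$-algebra of elements of the group algebra $E[\alpha_i(N)]$ fixed by $G$, where $G$ acts simultaneously on $E$ by Galois automorphisms and on $\alpha_i(N)$ by $\ast$. Let $\mathrm{Hol}(N)=\rho(N)\rtimes\mathrm{Aut}(N)$ be the holomorph, that is, the normalizer in $\mathrm{Perm}(N)$ of the left translations, with $\rho$ the right regular representation. Let $\beta_i:G\to\mathrm{Hol}(N)$ be the homomorphism corresponding to $\alpha_i$ under Byott's translation: $\beta_i(g)=a_i^{-1}\lambda(g)a_i$, where $a_i:N\to X$ is the bijection $\eta\mapsto\alpha_i(\eta)(\overline{1})$.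 Let $\overline{\beta_i}:G\to\mathrm{Aut}(N)$ be its composition with the projection onto the automorphism component, and let $G$ act on $N$ by $g\ast_i\eta=\overline{\beta_i}(g)[\eta]$. Let $\tilde E$ be the compositum of $E$ and $K(\zeta_e)$, where $e$ is the exponent of $N$ and $\zeta_e$ is a primitive $e$-th root of unity, and let $\Gamma=\mathrm{Gal}(\tilde E/K)$. Regard all the above actions of $G$ on $\alpha_i(N)$ and $N$ as actions of $\Gamma$ through the restriction map $\Gamma\to G$. If $\Gamma$ acts on a group $M$ by automorphisms, let it act on the set $\widehat M$ of characters $\chi:M\to\tilde E^\times$ by $(\gamma\ast\chi)[\eta]=\gamma(\chi[\gamma^{-1}\ast\eta])$; the resulting actions on $\widehat{\alpha_i(N)}$ and $\widehat N$ are again denoted $\ast$ and $\ast_i$. Suppose that $N$ is cyclic and that $K$ contains a primitive $|N|$-th root of unity. Then the following are equivalent: 1. $E[\alpha_1(N)]^G\cong E[\alpha_2(N)]^G$ as $K$-algebras; 2. $(\widehat{\alpha_1(N)},\ast)\cong(\widehat{\alpha_2(N)},\ast)$ as $\Gamma$-sets; 3. $(\widehat N,\ast_1)\cong(\widehat N,\ast_2)$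 as $\Gamma$-sets; 4. $(\alpha_1(N),\ast)\cong(\alpha_2(N),\ast)$ as $\Gamma$-sets; 5. $(N,\ast_1)\cong(N,\ast_2)$ as $\Gamma$-sets. Here an isomorphism of $\Gamma$-sets is a $\Gamma$-equivariant bijection. -/

import Mathlib

namespace HopfGalois

noncomputable section

/-! ### Isomorphism of `Γ`-sets and of groups with an action -/

/-- A `Γ`-set is given by the homomorphism from `Γ` to the permutations of the underlying set.
Two `Γ`-sets are isomorphic if there is a `Γ`-equivariant bijection between them. -/
def GSetIso {Γ A B : Type*} [Group Γ] (a : Γ →* Equiv.Perm A) (b : Γ →* Equiv.Perm B) : Prop :=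
  ∃ f : A ≃ B, ∀ (γ : Γ) (x : A), f (a γ x) = b γ (f x)

/-- The `Γ`-set underlying a `Γ`-group `(N, θ)`, where `θ : Γ →* MulAut N` is an action of `Γ`
on the group `N` via automorphisms. -/
def toGSet {Γ N : Type*} [Group Γ] [Group N] (θ : Γ →* MulAut N) : Γ →* Equiv.Perm N :=
  (MulAut.toPerm N).comp θ

/-- For a group `N` on which `Gal(F/K)` acts via `θ`, the map `χ ↦ γ ∗ χ` on characters
`N →* Fˣ` given by `(γ ∗ χ)(η) = γ (χ (γ⁻¹ ∗ η))`. -/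
def dualMap {K F N : Type*} [Field K] [Field F] [Algebra K F] [Group N]
    (θ : (F ≃ₐ[K] F) →* MulAut N) (γ : F ≃ₐ[K] F) (χ : N →* Fˣ) : N →* Fˣ :=
  (Units.map (γ : F →* F)).comp (χ.comp (θ γ⁻¹).toMonoidHom)

theorem dualMap_one {K F N : Type*} [Field K] [Field F] [Algebra K F] [Group N]
    (θ : (F ≃ₐ[K] F) →* MulAut N) (χ : N →* Fˣ) : dualMap θ 1 χ = χ := by
  ext η
  simp [dualMap]

theorem dualMap_mul {K F N : Type*} [Field K] [Field F] [Algebra K F] [Group N]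
    (θ : (F ≃ₐ[K] F) →* MulAut N) (γ δ : F ≃ₐ[K] F) (χ : N →* Fˣ) :
    dualMap θ (γ * δ) χ = dualMap θ γ (dualMap θ δ χ) := by
  ext η
  simp [dualMap]

/-- The dual action of `Gal(F/K)` on the characters `N →* Fˣ` of `N`,
`(γ ∗ χ)(η) = γ (χ (γ⁻¹ ∗ η))`. -/
def dualAction {K F N : Type*} [Field K] [Field F] [Algebra K F] [Group N]
    (θ : (F ≃ₐ[K] F) →* MulAut N) : (F ≃ₐ[K] F) →* Equiv.Perm (N →* Fˣ) where
  toFun γ :=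
    { toFun := dualMap θ γ
      invFun := dualMap θ γ⁻¹
      left_inv := fun χ => by rw [← dualMap_mul, inv_mul_cancel, dualMap_one]
      right_inv := fun χ => by rw [← dualMap_mul, mul_inv_cancel, dualMap_one] }
  map_one' := Equiv.ext (dualMap_one θ)
  map_mul' γ δ := Equiv.ext (dualMap_mul θ γ δ)

theorem dualAction_apply {K F N : Type*} [Field K] [Field F] [Algebra K F] [Group N]
    (θ : (F ≃ₐ[K] F) →* MulAut N) (γ : F ≃ₐ[K] F) (χ : N →* Fˣ) (η : N) :
    ((dualAction θ γ χ η : Fˣ) : F) = γ ((χ (θ γ⁻¹ η) : Fˣ) : F) := rfl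

/-! ### The fixed ring `E[N]^G` -/

/-- The simultaneous action of `G = Gal(E/K)` on `E[N]`: by Galois automorphisms on the
coefficients, and by `θ` on the group `N`. -/
def groupAlgebraAction {K E N : Type*} [Field K] [Field E] [Algebra K E] [Group N]
    (θ : (E ≃ₐ[K] E) →* MulAut N) (g : E ≃ₐ[K] E) :
    MonoidAlgebra E N →ₐ[K] MonoidAlgebra E N :=
  (MonoidAlgebra.mapDomainAlgHom K E (θ g).toMonoidHom).comp
    (MonoidAlgebra.mapAlgHom N (g : E →ₐ[K] E))

theorem groupAlgebraAction_single {K E N : Type*} [Field K] [Field E] [Algebra K E] [Group N]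
    (θ : (E ≃ₐ[K] E) →* MulAut N) (g : E ≃ₐ[K] E) (η : N) (c : E) :
    groupAlgebraAction θ g (MonoidAlgebra.single η c) = MonoidAlgebra.single (θ g η) (g c) := by
  simp [groupAlgebraAction]

/-- The `K`-algebra `E[N]^G` of elements of `E[N]` fixed by `G = Gal(E/K)`. -/
def fixedAlgebra {K E N : Type*} [Field K] [Field E] [Algebra K E] [Group N]
    (θ : (E ≃ₐ[K] E) →* MulAut N) : Subalgebra K (MonoidAlgebra E N) where
  carrier := {x | ∀ g : E ≃ₐ[K] E, groupAlgebraAction θ g x = x}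
  mul_mem' := by
    intro a b ha hb g
    rw [map_mul, ha g, hb g]
  add_mem' := by
    intro a b ha hb g
    rw [map_add, ha g, hb g]
  algebraMap_mem' := by
    intro r g
    exact AlgHom.commutes _ r

/-! ### The holomorph -/

/-- The left regular representation `λ : N → Perm(N)`. -/
def leftReg (N : Type*) [Group N] : N →* Equiv.Perm N := MulAction.toPermHom N N

/-- The right regular representation `ρ : N → Perm(N)`, `ρ(n)(x) = x n⁻¹`. -/
def rightReg (N : Type*) [Group N] : N →* Equiv.Perm N where
  toFun n := Equiv.mulRight n⁻¹
  map_one' := by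
    ext x
    simp
  map_mul' m n := by
    ext x
    simp [mul_assoc]

/-- The holomorph `Hol(N)`: the normalizer of `λ(N)` in `Perm(N)`. -/
def Hol (N : Type*) [Group N] : Subgroup (Equiv.Perm N) :=
  Subgroup.normalizer ((leftReg N).range : Set (Equiv.Perm N))

theorem hol_apply_mul {N : Type*} [Group N] {h : Equiv.Perm N} (hh : h ∈ Hol N) (x y : N) :
    h (x * y) = h x * (h 1)⁻¹ * h y := by
  have h1 : leftReg N x ∈ (leftReg N).range := ⟨x, rfl⟩
  obtain ⟨z, hz⟩ := (Subgroup.mem_normalizer_iff.mp hh (leftReg N x)).mp h1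
  have key : ∀ w, h (x * w) = z * h w := by
    intro w
    have := congrArg (fun p : Equiv.Perm N => p (h w)) hz
    simpa [leftReg] using this.symm
  have hx : h x = z * h 1 := by simpa using key 1
  rw [key y, hx]
  group

/-- The projection `Hol(N) = ρ(N) ⋊ Aut(N) → Aut(N)` onto the automorphism component; see
`hol_decomposition` and `holProj_unique`. -/
def holProj (N : Type*) [Group N] : Hol N →* MulAut N where
  toFun h :=
    { toEquiv := h.1.trans (Equiv.mulRight (h.1 1)⁻¹)
      map_mul' := by
        intro x y
        simp [hol_apply_mul h.2 x y, mul_assoc] }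
  map_one' := by
    ext x
    simp
  map_mul' := by
    intro a b
    ext x
    have h1 := hol_apply_mul a.2 (b.1 x * (b.1 1)⁻¹) (b.1 1)
    simp only [inv_mul_cancel_right] at h1
    simp [h1]

theorem hol_decomposition {N : Type*} [Group N] (h : Hol N) :
    ∃ n : N, (h : Equiv.Perm N) = rightReg N n * MulAut.toPerm N (holProj N h) := by
  refine ⟨(h.1 1)⁻¹, ?_⟩
  ext x
  have e : MulAut.toPerm N (holProj N h) x = h.1 x * (h.1 1)⁻¹ := rfl
  simp [rightReg, e]

theorem holProj_unique {N : Type*} [Group N] (h : Hol N) (n : N) (θ : MulAut N)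
    (e : (h : Equiv.Perm N) = rightReg N n * MulAut.toPerm N θ) : holProj N h = θ := by
  have t : ∀ y, MulAut.toPerm N θ y = θ y := fun _ => rfl
  ext x
  simp [holProj, e, rightReg, t]

/-! ### Regular subgroups of `Perm(X)` normalized by `λ(G)`, and Byott's translation

Throughout `E / K` is a field extension with group `G = Gal(E/K)` and `L` is an intermediate
field, with `G_L = Gal(E/L)`. -/

/-- The left coset space `X = G / G_L`. -/
abbrev Cosets {K E : Type*} [Field K] [Field E] [Algebra K E] (L : IntermediateField K E) :
    Type _ :=
  (E ≃ₐ[K] E) ⧸ L.fixingSubgroup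

/-- The homomorphism `λ : G → Perm(X)` given by left translation of cosets. -/
def cosetTranslation {K E : Type*} [Field K] [Field E] [Algebra K E]
    (L : IntermediateField K E) : (E ≃ₐ[K] E) →* Equiv.Perm (Cosets L) :=
  MulAction.toPermHom (E ≃ₐ[K] E) (Cosets L)

/-- A subgroup of `Perm(X)` is regular if it has the same size as `X` and is transitive on `X`
(`X` is finite where this is used). -/
def IsRegularSubgroup {X : Type*} (M : Subgroup (Equiv.Perm X)) : Prop :=
  Nat.card M = Nat.card X ∧ MulAction.IsPretransitive M X

/-- An embedding `α : N ↪ Perm(X)` whose image is regular and normalized by `λ(G)`. -/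
structure RegularEmbedding {K E : Type*} [Field K] [Field E] [Algebra K E]
    (L : IntermediateField K E) (N : Type*) [Group N] where
  /-- the underlying homomorphism -/
  hom : N →* Equiv.Perm (Cosets L)
  injective : Function.Injective hom
  regular : IsRegularSubgroup hom.range
  normalized : (cosetTranslation L).range ≤
    Subgroup.normalizer (hom.range : Set (Equiv.Perm (Cosets L)))

namespace RegularEmbedding

variable {K E : Type*} [Field K] [Field E] [Algebra K E] {L : IntermediateField K E}
  {N : Type*} [Group N]

/-- The group `α(N)`. -/
abbrev image (α : RegularEmbedding L N) : Subgroup (Equiv.Perm (Cosets L)) := α.hom.range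

/-- The action `∗` of `G` on `α(N)`: `σ ∗ η = λ(σ) η λ(σ)⁻¹`. -/
def conjAction (α : RegularEmbedding L N) : (E ≃ₐ[K] E) →* MulAut α.image :=
  (Subgroup.normalizerMonoidHom α.image).comp
    ((cosetTranslation L).codRestrict _ fun g => α.normalized ⟨g, rfl⟩)

theorem conjAction_apply (α : RegularEmbedding L N) (g : E ≃ₐ[K] E) (η : α.image) :
    (α.conjAction g η : Equiv.Perm (Cosets L)) =
      cosetTranslation L g * η * (cosetTranslation L g)⁻¹ := rfl

theorem eval_bijective [FiniteDimensional K E] (α : RegularEmbedding L N) :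
    Function.Bijective fun η : N => α.hom η ((1 : E ≃ₐ[K] E) : Cosets L) := by
  have hs : Function.Surjective fun η : N => α.hom η ((1 : E ≃ₐ[K] E) : Cosets L) := by
    intro x
    obtain ⟨⟨_, η, rfl⟩, h⟩ :=
      α.regular.2.exists_smul_eq ((1 : E ≃ₐ[K] E) : Cosets L) x
    exact ⟨η, h⟩
  have hc : Nat.card N = Nat.card (Cosets L) :=
    (Nat.card_congr (MonoidHom.ofInjective α.injective).toEquiv).trans α.regular.1
  have : Finite N := Nat.finite_of_card_ne_zero (by rw [hc]; exact Nat.card_pos.ne')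
  exact (Nat.bijective_iff_surjective_and_card _).mpr ⟨hs, hc⟩

/-- The bijection `N → X`, `η ↦ α(η)(ē)`, where `ē` is the trivial coset. -/
def evalEquiv [FiniteDimensional K E] (α : RegularEmbedding L N) : N ≃ Cosets L :=
  Equiv.ofBijective _ α.eval_bijective

/-- For `a : N → X`, `a(η) = α(η)(ē)`, this is `g ↦ a⁻¹ λ(g) a`, a homomorphism
`G → Perm(N)`. -/
def translationPerm [FiniteDimensional K E] (α : RegularEmbedding L N) :
    (E ≃ₐ[K] E) →* Equiv.Perm N :=
  (α.evalEquiv.symm.permCongrHom.toMonoidHom).comp (cosetTranslation L)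

theorem translationPerm_apply [FiniteDimensional K E] (α : RegularEmbedding L N)
    (g : E ≃ₐ[K] E) (x : N) :
    α.translationPerm g x = α.evalEquiv.symm (cosetTranslation L g (α.evalEquiv x)) := rfl

theorem evalEquiv_mul [FiniteDimensional K E] (α : RegularEmbedding L N) (m x : N) :
    α.evalEquiv (m * x) = α.hom m (α.evalEquiv x) := by
  simp [evalEquiv]

theorem permCongr_leftReg [FiniteDimensional K E] (α : RegularEmbedding L N) (m : N) :
    α.evalEquiv.permCongrHom (leftReg N m) = α.hom m := by
  ext x
  simp [Equiv.permCongrHom, leftReg, evalEquiv_mul]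

theorem translationPerm_mem_hol [FiniteDimensional K E] (α : RegularEmbedding L N)
    (g : E ≃ₐ[K] E) : α.translationPerm g ∈ Hol N := by
  have hg : α.evalEquiv.permCongrHom (α.translationPerm g) = cosetTranslation L g := by
    ext x
    simp [Equiv.permCongrHom, translationPerm_apply]
  have hr : ∀ p : Equiv.Perm N, p ∈ (leftReg N).range ↔
      α.evalEquiv.permCongrHom p ∈ α.hom.range := by
    intro p
    constructor
    · rintro ⟨m, rfl⟩
      exact ⟨m, (α.permCongr_leftReg m).symm⟩
    · rintro ⟨m, hm⟩
      exact ⟨m, α.evalEquiv.permCongrHom.injective ((α.permCongr_leftReg m).trans hm)⟩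
  refine Subgroup.mem_normalizer_iff.mpr fun p => ?_
  have hn := Subgroup.mem_normalizer_iff.mp (α.normalized ⟨g, rfl⟩)
    (α.evalEquiv.permCongrHom p)
  rw [hr, hr, map_mul, map_mul, map_inv, hg]
  exact hn

/-- The homomorphism `β : G → Hol(N)` corresponding to `α` under Byott's translation. -/
def beta [FiniteDimensional K E] (α : RegularEmbedding L N) : (E ≃ₐ[K] E) →* Hol N :=
  α.translationPerm.codRestrict (Hol N) α.translationPerm_mem_hol

/-- The composition `G → Hol(N) → Aut(N)` of `β` with the projection onto the automorphism
component. It gives the action `g ∗_α η = β̄(g)[η]` of `G` on `N`. -/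
def betaBar [FiniteDimensional K E] (α : RegularEmbedding L N) : (E ≃ₐ[K] E) →* MulAut N :=
  (holProj N).comp α.beta

end RegularEmbedding

/-! ### Extension to `Γ = Gal(Ẽ/K)` -/

/-- For `K ⊆ E ⊆ F` with `E / K` normal, an action of `Gal(E/K)` on a group, viewed as an action
of `Gal(F/K)` through restriction to `E`. -/
def inflate {K E : Type*} (F : Type*) {N : Type*} [Field K] [Field E] [Field F] [Algebra K E]
    [Algebra K F] [Algebra E F] [IsScalarTower K E F] [Normal K E] [Group N]
    (θ : (E ≃ₐ[K] E) →* MulAut N) : (F ≃ₐ[K] F) →* MulAut N :=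
  θ.comp (AlgEquiv.restrictNormalHom E)

end

end HopfGalois

/-! A cyclic `N` has exponent |N|, so the roots of unity adjoined to `E` already lie in `K`: `E → F`
is bijective and Γ carries the same information as G. Characters take values in `K`, so γ acts on
them purely by precomposition with γ⁻¹. Automorphisms of a cyclic group are power maps, so a duality
M ≅ M^ turns this into the action of γ⁻¹ on M (`exists_equiv_dualAction`). Equivariance for all γ
and for all γ⁻¹ are the same condition, so characters and groups give the same classification;
`conjAction_ofInjective` passes between N and α(N).

For the algebras, evaluation at characters identifies E[M] with the functions M^ → E, and the fixed
algebra with the G-equivariant ones (`mem_fixedAlgebra_iff`), so the G-set M^ determines the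
algebra. Conversely, the `K`-algebra maps from the fixed algebra to `E` are exactly the evaluations
at characters, with G acting by postcomposition (`fixedEval_injective`, `fixedEval_surjective`), so
the algebra determines M^. -/

namespace HopfGalois

/-! ### Formal properties of isomorphism of Γ-sets. -/

section GSets

variable {Γ Δ A B C D : Type*} [Group Γ] [Group Δ]

theorem GSetIso.symm {a : Γ →* Equiv.Perm A} {b : Γ →* Equiv.Perm B} (h : GSetIso a b) :
    GSetIso b a := by
  obtain ⟨f, hf⟩ := h
  exact ⟨f.symm, fun γ x => by rw [Equiv.symm_apply_eq, hf, f.apply_symm_apply]⟩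

theorem GSetIso.trans {a : Γ →* Equiv.Perm A} {b : Γ →* Equiv.Perm B} {c : Γ →* Equiv.Perm C}
    (h : GSetIso a b) (h' : GSetIso b c) : GSetIso a c := by
  obtain ⟨f, hf⟩ := h
  obtain ⟨k, hk⟩ := h'
  exact ⟨f.trans k, fun γ x => by simp [hf, hk]⟩

theorem GSetIso.congr {a : Γ →* Equiv.Perm A} {b : Γ →* Equiv.Perm B} {c : Γ →* Equiv.Perm C}
    {d : Γ →* Equiv.Perm D} (hac : GSetIso a c) (hbd : GSetIso b d) :
    GSetIso a b ↔ GSetIso c d :=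
  ⟨fun h => (hac.symm.trans h).trans hbd, fun h => (hac.trans h).trans hbd.symm⟩

/-- If the sets are identified by bijections under which `γ⁻¹` acts on one as `γ` acts on the
other, then isomorphism classes are detected on either side. -/
theorem GSetIso.congr_inv {a : Γ →* Equiv.Perm A} {b : Γ →* Equiv.Perm B}
    {c : Γ →* Equiv.Perm C} {d : Γ →* Equiv.Perm D} (e : A ≃ C) (e' : B ≃ D)
    (he : ∀ γ x, c γ (e x) = e (a γ⁻¹ x)) (he' : ∀ γ x, d γ (e' x) = e' (b γ⁻¹ x)) :
    GSetIso a b ↔ GSetIso c d := by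
  constructor
  · rintro ⟨f, hf⟩
    refine ⟨(e.symm.trans f).trans e', fun γ x => ?_⟩
    obtain ⟨y, rfl⟩ := e.surjective x
    simp only [Equiv.trans_apply, he, he', hf, e.symm_apply_apply]
  · rintro ⟨f, hf⟩
    refine ⟨(e.trans f).trans e'.symm, fun γ x => ?_⟩
    have h := hf γ⁻¹ (e x)
    rw [he, inv_inv] at h
    simp only [Equiv.trans_apply, Equiv.symm_apply_eq, h]
    obtain ⟨y, hy⟩ := e'.surjective (f (e x))
    rw [← hy, he', inv_inv, e'.symm_apply_apply]

theorem GSetIso.comp_iff {a : Γ →* Equiv.Perm A} {b : Γ →* Equiv.Perm B} {φ : Δ →* Γ}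
    (hφ : Function.Surjective φ) : GSetIso (a.comp φ) (b.comp φ) ↔ GSetIso a b := by
  constructor
  · rintro ⟨f, hf⟩
    refine ⟨f, fun γ x => ?_⟩
    obtain ⟨δ, rfl⟩ := hφ γ
    exact hf δ x
  · rintro ⟨f, hf⟩
    exact ⟨f, fun δ x => hf (φ δ) x⟩

end GSets

/-! ### Duality for cyclic groups. -/

section Duality

variable {K F M M' : Type*} [Field K] [Field F] [Algebra K F] [Group M] [Group M']

theorem toGSet_apply {Γ : Type*} [Group Γ] (θ : Γ →* MulAut M) (γ : Γ) (x : M) :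
    toGSet θ γ x = θ γ x := rfl

theorem GSetIso.of_mulEquiv {Γ : Type*} [Group Γ] {θ : Γ →* MulAut M} {θ' : Γ →* MulAut M'}
    (e : M ≃* M') (he : ∀ γ x, e (θ γ x) = θ' γ (e x)) : GSetIso (toGSet θ) (toGSet θ') :=
  ⟨e.toEquiv, he⟩

/-- The characters of a finite group take values in `K` if `K` contains enough roots of unity. -/
theorem galois_apply_character [Finite M] {ζ : K} (hζ : IsPrimitiveRoot ζ (Nat.card M))
    (γ : F ≃ₐ[K] F) (χ : M →* Fˣ) (x : M) : γ (χ x : F) = (χ x : F) := by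
  have : NeZero (Nat.card M) := ⟨Nat.card_pos.ne'⟩
  have hF : IsPrimitiveRoot (algebraMap K F ζ) (Nat.card M) :=
    hζ.map_of_injective (algebraMap K F).injective
  have h1 : (χ x : F) ^ Nat.card M = 1 := by
    rw [← Units.val_pow_eq_pow_val, ← map_pow, pow_card_eq_one', map_one, Units.val_one]
  obtain ⟨i, -, hi⟩ := hF.eq_pow_of_pow_eq_one h1
  rw [← hi, ← map_pow, γ.commutes]

variable (F M) in
-- Compatibility with powers is all that is needed of the self-duality: it moves a power map from
-- the group to the argument of the character.
theorem exists_mulEquiv_characters [Finite M] [IsCyclic M] {ζ : F}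
    (hζ : IsPrimitiveRoot ζ (Nat.card M)) :
    ∃ e : M ≃ (M →* Fˣ), ∀ (x : M) (m : ℤ) (y : M), e (x ^ m) y = e x (y ^ m) := by
  let : CommGroup M := IsCyclic.commGroup
  have : NeZero (Nat.card M) := ⟨Nat.card_pos.ne'⟩
  have : HasEnoughRootsOfUnity F (Nat.card M) := ⟨⟨ζ, hζ⟩, inferInstance⟩
  obtain ⟨e⟩ := IsCyclic.monoidHom_equiv_self M F
  exact ⟨e.symm.toEquiv, fun x m y => by simp [map_zpow]⟩

/-- A finite cyclic group is identified with its characters in such a way that `γ` acts on the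
characters as `γ⁻¹` acts on the group. -/
theorem exists_equiv_dualAction [Finite M] [IsCyclic M] {ζ : K}
    (hζ : IsPrimitiveRoot ζ (Nat.card M)) (θ : (F ≃ₐ[K] F) →* MulAut M) :
    ∃ e : M ≃ (M →* Fˣ), ∀ γ x, dualAction θ γ (e x) = e (toGSet θ γ⁻¹ x) := by
  obtain ⟨e, he⟩ := exists_mulEquiv_characters F M
    (hζ.map_of_injective (algebraMap K F).injective)
  refine ⟨e, fun γ x => ?_⟩
  -- An endomorphism of a cyclic group is a power map.
  obtain ⟨m, hm⟩ := MonoidHom.map_cyclic (θ γ⁻¹).toMonoidHom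
  replace hm : ∀ y, θ γ⁻¹ y = y ^ m := hm
  ext y
  rw [dualAction_apply, galois_apply_character hζ, hm, toGSet_apply, hm, he]

/-- For cyclic groups and in the presence of roots of unity, a group with action is determined
up to isomorphism of sets with action by its characters, and conversely. -/
theorem dualAction_iso_iff_toGSet_iso [Finite M] [IsCyclic M] [Finite M'] [IsCyclic M']
    {ζ : K} (hζ : IsPrimitiveRoot ζ (Nat.card M)) (hM : Nat.card M' = Nat.card M)
    (θ : (F ≃ₐ[K] F) →* MulAut M) (θ' : (F ≃ₐ[K] F) →* MulAut M') :
    GSetIso (dualAction θ) (dualAction θ') ↔ GSetIso (toGSet θ) (toGSet θ') := by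
  obtain ⟨e, he⟩ := exists_equiv_dualAction hζ θ
  obtain ⟨e', he'⟩ := exists_equiv_dualAction (hM.symm ▸ hζ) θ'
  exact (GSetIso.congr_inv e e' he he').symm

end Duality

/-! ### The group algebra as functions on characters. -/

section Characters

variable {K E M M' : Type*} [Field K] [Field E] [Algebra K E] [Group M] [Group M']

/-- The evaluation of elements of the group algebra at a character. -/
noncomputable def charEval (χ : M →* Eˣ) : MonoidAlgebra E M →ₐ[E] E :=
  MonoidAlgebra.lift E E M ((Units.coeHom E).comp χ)

theorem charEval_single (χ : M →* Eˣ) (x : M) (c : E) :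
    charEval χ (MonoidAlgebra.single x c) = c * χ x := by
  simp [charEval]

theorem charEval_eq_sum [Fintype M] (χ : M →* Eˣ) (x : MonoidAlgebra E M) :
    charEval χ x = ∑ η, x.coeff η * (χ η : E) := by
  rw [charEval, MonoidAlgebra.lift_apply, Finsupp.sum_fintype _ _ (by simp)]
  rfl

/-- The twist by g⁻¹ in the dual action cancels the action of g on M, leaving only g on values. -/
theorem charEval_dualAction (θ : (E ≃ₐ[K] E) →* MulAut M) (g : E ≃ₐ[K] E) (χ : M →* Eˣ)
    (x : MonoidAlgebra E M) :
    charEval (dualAction θ g χ) (groupAlgebraAction θ g x) = g (charEval χ x) := by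
  induction x using MonoidAlgebra.induction_linear with
  | zero => simp
  | add x y hx hy => simp only [map_add, hx, hy]
  | single η c =>
    rw [groupAlgebraAction_single, charEval_single, charEval_single, dualAction_apply,
      ← MulAut.mul_apply, ← map_mul]
    simp

/-- The evaluation of elements of the group algebra at all characters. -/
noncomputable def charTransform (E M : Type*) [Field E] [Group M] :
    MonoidAlgebra E M →ₐ[E] ((M →* Eˣ) → E) :=
  AlgHom.pi charEval

theorem charTransform_apply (x : MonoidAlgebra E M) (χ : M →* Eˣ) :
    charTransform E M x χ = charEval χ x := rfl

theorem linearIndependent_characters (E M : Type*) [Field E] [Group M] :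
    LinearIndependent E fun (χ : M →* Eˣ) (η : M) => (χ η : E) :=
  (linearIndependent_monoidHom M E).comp (fun χ : M →* Eˣ => (Units.coeHom E).comp χ)
    fun χ χ' h => by
      ext η
      exact DFunLike.congr_fun h η

/-- By Dedekind the characters are independent; being |M| in number, they form a basis of the
functions on M. -/
theorem charTransform_bijective [Finite M] (hc : Nat.card (M →* Eˣ) = Nat.card M) :
    Function.Bijective (charTransform E M) := by
  cases nonempty_fintype M
  have : Finite (M →* Eˣ) := Nat.finite_of_card_ne_zero (by rw [hc]; exact Nat.card_pos.ne')
  cases nonempty_fintype (M →* Eˣ)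
  rw [Nat.card_eq_fintype_card, Nat.card_eq_fintype_card] at hc
  have hspan := (linearIndependent_characters E M).span_eq_top_of_card_eq_finrank' (by simp [hc])
  have hinj : Function.Injective (charTransform E M).toLinearMap := by
    rw [← LinearMap.ker_eq_bot, LinearMap.ker_eq_bot']
    intro x hx
    -- The coefficients of `x`, read as a functional on M → E, vanish on the spanning set of
    -- characters.
    have h0 : (∑ η, x.coeff η • LinearMap.proj η : (M → E) →ₗ[E] E) = 0 := by
      refine LinearMap.ext_on_range hspan fun χ => ?_
      have := congrFun hx χ
      rw [AlgHom.toLinearMap_apply, charTransform_apply, charEval_eq_sum] at this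
      simpa using this
    classical
    ext η
    simpa [Pi.single_apply] using LinearMap.congr_fun h0 (Pi.single η 1)
  have hrank : Module.finrank E (MonoidAlgebra E M) = Module.finrank E ((M →* Eˣ) → E) := by
    rw [(MonoidAlgebra.coeffLinearEquiv (S := E) (M := M) E).finrank_eq]
    simp [hc]
  have : FiniteDimensional E (MonoidAlgebra E M) :=
    Module.Finite.equiv (MonoidAlgebra.coeffLinearEquiv (S := E) (M := M) E).symm
  exact ⟨hinj, (LinearMap.injective_iff_surjective_of_finrank_eq_finrank hrank).mp hinj⟩

theorem eq_of_charEval_eq [Finite M] (hc : Nat.card (M →* Eˣ) = Nat.card M)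
    {x y : MonoidAlgebra E M} (h : ∀ χ, charEval χ x = charEval χ y) : x = y :=
  (charTransform_bijective hc).1 (funext h)

theorem mem_fixedAlgebra_iff [Finite M] (hc : Nat.card (M →* Eˣ) = Nat.card M)
    (θ : (E ≃ₐ[K] E) →* MulAut M) (x : MonoidAlgebra E M) :
    x ∈ fixedAlgebra θ ↔ ∀ g χ, charEval (dualAction θ g χ) x = g (charEval χ x) := by
  constructor
  · intro hx g χ
    rw [← charEval_dualAction, hx g]
  · intro h g
    refine eq_of_charEval_eq hc fun χ => ?_
    obtain ⟨χ, rfl⟩ := (dualAction θ g).surjective χ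
    rw [charEval_dualAction, h]

/-- Isomorphic sets of characters give isomorphic fixed algebras. -/
theorem fixedAlgebra_equiv_of_iso [Finite M] [Finite M']
    (hc : Nat.card (M →* Eˣ) = Nat.card M) (hc' : Nat.card (M' →* Eˣ) = Nat.card M')
    {θ : (E ≃ₐ[K] E) →* MulAut M} {θ' : (E ≃ₐ[K] E) →* MulAut M'}
    (h : GSetIso (dualAction θ) (dualAction θ')) :
    Nonempty (fixedAlgebra θ ≃ₐ[K] fixedAlgebra θ') := by
  obtain ⟨f, hf⟩ := h
  let Ψ : MonoidAlgebra E M ≃ₐ[E] MonoidAlgebra E M' :=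
    ((AlgEquiv.ofBijective _ (charTransform_bijective hc)).trans
      (AlgEquiv.piCongrLeft E (fun _ => E) f)).trans
      (AlgEquiv.ofBijective _ (charTransform_bijective hc')).symm
  have hΨ : ∀ χ x, charEval (f χ) (Ψ x) = charEval χ x := by
    intro χ x
    have h1 : charTransform E M' (Ψ x) =
        AlgEquiv.piCongrLeft E (fun _ => E) f (charTransform E M x) :=
      (AlgEquiv.ofBijective _ (charTransform_bijective hc')).apply_symm_apply _
    rw [← charTransform_apply, h1]
    exact Equiv.piCongrLeft_apply_apply (fun _ => E) f _ χ
  have hmem : ∀ x, Ψ x ∈ fixedAlgebra θ' ↔ x ∈ fixedAlgebra θ := by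
    intro x
    rw [mem_fixedAlgebra_iff hc, mem_fixedAlgebra_iff hc']
    refine forall_congr' fun g => (f.forall_congr fun χ => ?_).symm
    rw [← hf, hΨ, hΨ]
  have hmap : (fixedAlgebra θ).map (Ψ.restrictScalars K : _ →ₐ[K] _) = fixedAlgebra θ' := by
    ext y
    rw [Subalgebra.mem_map]
    constructor
    · rintro ⟨x, hx, rfl⟩
      exact (hmem x).mpr hx
    · intro hy
      obtain ⟨x, rfl⟩ := Ψ.surjective y
      exact ⟨x, (hmem x).mp hy, rfl⟩
  exact ⟨((Ψ.restrictScalars K).subalgebraMap _).trans (Subalgebra.equivOfEq _ _ hmap)⟩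

/-! ### Recovering the characters from the fixed algebra. -/

/-- The restriction of the evaluation at a character to the fixed algebra. -/
noncomputable def fixedEval (θ : (E ≃ₐ[K] E) →* MulAut M) (χ : M →* Eˣ) :
    fixedAlgebra θ →ₐ[K] E :=
  ((charEval χ).restrictScalars K).comp (fixedAlgebra θ).val

theorem fixedEval_apply (θ : (E ≃ₐ[K] E) →* MulAut M) (χ : M →* Eˣ) (x : fixedAlgebra θ) :
    fixedEval θ χ x = charEval χ (x : MonoidAlgebra E M) := rfl

theorem fixedEval_dualAction (θ : (E ≃ₐ[K] E) →* MulAut M) (g : E ≃ₐ[K] E) (χ : M →* Eˣ) :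
    fixedEval θ (dualAction θ g χ) = (g : E →ₐ[K] E).comp (fixedEval θ χ) := by
  ext x
  have := charEval_dualAction θ g χ x
  rwa [x.2 g] at this

theorem groupAlgebraAction_mul (θ : (E ≃ₐ[K] E) →* MulAut M) (g h : E ≃ₐ[K] E)
    (x : MonoidAlgebra E M) :
    groupAlgebraAction θ (g * h) x = groupAlgebraAction θ g (groupAlgebraAction θ h x) := by
  induction x using MonoidAlgebra.induction_linear with
  | zero => simp
  | add x y hx hy => simp only [map_add, hx, hy]
  | single η c => simp [groupAlgebraAction_single]

/-- Comparing values on the traces of c·η, for all c in `E`, gives a linear relation among the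
automorphisms of `E`; by Dedekind its coefficients vanish, and the one at g = 1 is χ(η) − χ'(η). -/
theorem fixedEval_injective [FiniteDimensional K E] (θ : (E ≃ₐ[K] E) →* MulAut M) :
    Function.Injective (fixedEval θ) := by
  intro χ χ' h
  have htr : ∀ x : MonoidAlgebra E M, ∑ g, groupAlgebraAction θ g x ∈ fixedAlgebra θ := by
    intro x g
    rw [map_sum]
    simp_rw [← groupAlgebraAction_mul]
    exact Equiv.sum_comp (Equiv.mulLeft g) fun k => groupAlgebraAction θ k x
  ext η
  have hli := (linearIndependent_monoidHom E E).comp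
    (fun g : E ≃ₐ[K] E => ((g : E →ₐ[K] E) : E →* E)) fun g g' hg => by
      ext c
      exact DFunLike.congr_fun hg c
  have hz := Fintype.linearIndependent_iff.mp hli
    (fun g => (χ (θ g η) : E) - (χ' (θ g η) : E)) (by
      ext c
      have h1 := DFunLike.congr_fun h ⟨_, htr (MonoidAlgebra.single η c)⟩
      simp only [fixedEval_apply, map_sum, groupAlgebraAction_single, charEval_single] at h1
      simp only [Finset.sum_apply, Pi.smul_apply, Function.comp_apply, smul_eq_mul, sub_mul,
        Finset.sum_sub_distrib, Pi.zero_apply, sub_eq_zero]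
      refine (Eq.trans ?_ h1).trans ?_ <;> exact Finset.sum_congr rfl fun g _ => mul_comm _ _) 1
  simpa [sub_eq_zero] using hz

/-- Any φ agrees at each x with some character, because φ(x) is a root of ∏ (X − χ(x)). A vector
space over an infinite field is not a finite union of proper subspaces, so one character works for
all x. -/
theorem fixedEval_surjective [FiniteDimensional K E] [IsGalois K E] [Infinite K] [Finite M]
    (hc : Nat.card (M →* Eˣ) = Nat.card M) (θ : (E ≃ₐ[K] E) →* MulAut M) :
    Function.Surjective (fixedEval θ) := by
  intro φ
  have : Finite (M →* Eˣ) := Nat.finite_of_card_ne_zero (by rw [hc]; exact Nat.card_pos.ne')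
  cases nonempty_fintype (M →* Eˣ)
  have hpt : ∀ x, ∃ χ, fixedEval θ χ x = φ x := by
    intro x
    let p : Polynomial E := ∏ χ, (Polynomial.X - Polynomial.C (fixedEval θ χ x))
    -- Applying g permutes the factors through the dual action, so `p` descends to `K`.
    have hp : ∀ g : E ≃ₐ[K] E, p.map (g : E →+* E) = p := by
      intro g
      rw [Polynomial.map_prod]
      refine Eq.trans ?_ (Equiv.prod_comp (dualAction θ g)
        fun χ => Polynomial.X - Polynomial.C (fixedEval θ χ x))
      refine Finset.prod_congr rfl fun χ _ => ?_
      rw [fixedEval_dualAction]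
      simp
    have hlift : p ∈ Polynomial.lifts (algebraMap K E) := by
      rw [Polynomial.lifts_iff_coeff_lifts]
      intro n
      rw [IsGalois.mem_range_algebraMap_iff_fixed]
      intro g
      conv_rhs => rw [← hp g]
      simp
    obtain ⟨q, hq⟩ := (Polynomial.mem_lifts _).mp hlift
    have hroot : Polynomial.aeval x q = 0 := by
      rw [← Subtype.coe_inj, ← Subalgebra.coe_val, ← Polynomial.aeval_algHom_apply]
      refine eq_of_charEval_eq hc fun χ => ?_
      have h2 : charEval χ (Polynomial.aeval ((fixedAlgebra θ).val x) q) =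
          Polynomial.aeval (fixedEval θ χ x) q :=
        (Polynomial.aeval_algHom_apply ((charEval χ).restrictScalars K) _ q).symm
      rw [h2, ← Polynomial.eval_map_algebraMap, hq, Polynomial.eval_prod]
      simpa using Finset.prod_eq_zero (Finset.mem_univ χ) (by simp)
    have h3 : p.eval (φ x) = 0 := by
      rw [← hq, Polynomial.eval_map_algebraMap, Polynomial.aeval_algHom_apply, hroot, map_zero]
    rw [Polynomial.eval_prod, Finset.prod_eq_zero_iff] at h3
    obtain ⟨χ, -, h4⟩ := h3
    exact ⟨χ, by simpa [sub_eq_zero, eq_comm (a := φ x)] using h4⟩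
  obtain ⟨χ, hχ⟩ := Subspace.exists_eq_top_of_iUnion_eq_univ
    (p := fun χ => LinearMap.eqLocus (fixedEval θ χ).toLinearMap φ.toLinearMap) (by
      rw [Set.eq_univ_iff_forall]
      intro x
      obtain ⟨χ, h⟩ := hpt x
      exact Set.mem_iUnion.mpr ⟨χ, h⟩)
  exact ⟨χ, AlgHom.toLinearMap_injective (LinearMap.eqLocus_eq_top.mp hχ)⟩

/-- Isomorphic fixed algebras have isomorphic sets of characters. -/
theorem iso_of_fixedAlgebra_equiv [FiniteDimensional K E] [IsGalois K E] [Infinite K] [Finite M]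
    [Finite M'] (hc : Nat.card (M →* Eˣ) = Nat.card M)
    (hc' : Nat.card (M' →* Eˣ) = Nat.card M')
    {θ : (E ≃ₐ[K] E) →* MulAut M} {θ' : (E ≃ₐ[K] E) →* MulAut M'}
    (σ : fixedAlgebra θ ≃ₐ[K] fixedAlgebra θ') :
    GSetIso (dualAction θ) (dualAction θ') := by
  let e := Equiv.ofBijective _ ⟨fixedEval_injective θ, fixedEval_surjective hc θ⟩
  let e' := Equiv.ofBijective _ ⟨fixedEval_injective θ', fixedEval_surjective hc' θ'⟩
  -- Precomposition with σ⁻¹ commutes with the postcomposition by which G acts.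
  refine ⟨(e.trans (σ.arrowCongr AlgEquiv.refl)).trans e'.symm, fun g χ => ?_⟩
  rw [Equiv.trans_apply, Equiv.symm_apply_eq]
  have h1 : ∀ ψ, e' ψ = fixedEval θ' ψ := fun _ => rfl
  have h2 : ∀ ψ, e ψ = fixedEval θ ψ := fun _ => rfl
  rw [h1, fixedEval_dualAction, ← h1]
  simp only [Equiv.trans_apply, Equiv.apply_symm_apply, h2, fixedEval_dualAction]
  rfl

end Characters

/-! ### Byott's translation. -/

namespace RegularEmbedding

variable {K E : Type*} [Field K] [Field E] [Algebra K E] {L : IntermediateField K E}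
  {N : Type*} [Group N] [FiniteDimensional K E]

/-- Byott's translation: `α` is equivariant for the actions on `N` and on `α(N)`. -/
theorem conjAction_ofInjective (α : RegularEmbedding L N) (g : E ≃ₐ[K] E) (η : N) :
    MonoidHom.ofInjective α.injective (α.betaBar g η) =
      α.conjAction g (MonoidHom.ofInjective α.injective η) := by
  obtain ⟨ν, hν⟩ := (MonoidHom.ofInjective α.injective).surjective
    (α.conjAction g (MonoidHom.ofInjective α.injective η))
  rw [← hν]
  congr 1
  have h1 : α.hom ν = cosetTranslation L g * α.hom η * (cosetTranslation L g)⁻¹ :=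
    congrArg Subtype.val hν
  have h2 : α.betaBar g η = α.translationPerm g η * (α.translationPerm g 1)⁻¹ := rfl
  rw [h2, mul_inv_eq_iff_eq_mul]
  -- By regularity it suffices to compare images of the base coset.
  apply α.evalEquiv.injective
  rw [evalEquiv_mul, translationPerm_apply, translationPerm_apply, h1]
  rw [Equiv.apply_symm_apply, Equiv.apply_symm_apply, Equiv.Perm.mul_apply, Equiv.Perm.mul_apply,
    ← Equiv.Perm.mul_apply _⁻¹, inv_mul_cancel, Equiv.Perm.one_apply, ← evalEquiv_mul, mul_one]

end RegularEmbedding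

/-! ### Consequences of the roots of unity, and the main theorem. -/

/-- A cyclotomic extension generated by roots of unity of the base field is trivial. -/
theorem algebraMap_surjective_of_isCyclotomicExtension {E F : Type*} [Field E] [Field F]
    [Algebra E F] {n : ℕ} [IsCyclotomicExtension {n} E F] {ζ : E} (hζ : IsPrimitiveRoot ζ n) :
    Function.Surjective (algebraMap E F) := by
  intro x
  refine Algebra.mem_bot.mp (Algebra.adjoin_le ?_
    (IsCyclotomicExtension.adjoin_roots (S := {n}) (A := E) x))
  rintro b ⟨m, rfl, hm, hb⟩
  have : NeZero m := ⟨hm⟩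
  obtain ⟨i, -, hi⟩ := (hζ.map_of_injective (algebraMap E F).injective).eq_pow_of_pow_eq_one hb
  exact Algebra.mem_bot.mpr ⟨ζ ^ i, by rw [map_pow, hi]⟩

theorem card_characters {E M : Type*} [Field E] [Group M] [Finite M] [IsCyclic M] {ζ : E}
    (hζ : IsPrimitiveRoot ζ (Nat.card M)) : Nat.card (M →* Eˣ) = Nat.card M := by
  obtain ⟨e, -⟩ := exists_mulEquiv_characters E M hζ
  exact (Nat.card_congr e).symm

end HopfGalois

/-- `E / K` is the Galois closure of `L / K`, `F = Ẽ` is the compositum of `E` and `K(ζ_e)`, where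
`e` is the exponent of `N`, and `Γ = Gal(F/K)`. -/
theorem mainTheorem6 {K E F : Type*} [Field K] [CharZero K] [Field E] [Algebra K E]
    [FiniteDimensional K E] [IsGalois K E]
    (L : IntermediateField K E) [IsNormalClosure K L E]
    {N : Type*} [Group N] [IsCyclic N]
    [Field F] [Algebra K F] [Algebra E F] [IsScalarTower K E F]
    [IsCyclotomicExtension {Monoid.exponent N} E F]
    (hζ : ∃ ζ : K, IsPrimitiveRoot ζ (Nat.card N))
    (α₁ α₂ : HopfGalois.RegularEmbedding L N) :
    List.TFAE
      [Nonempty (HopfGalois.fixedAlgebra α₁.conjAction ≃ₐ[K]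
          HopfGalois.fixedAlgebra α₂.conjAction),
        HopfGalois.GSetIso
          (HopfGalois.dualAction (HopfGalois.inflate F α₁.conjAction))
          (HopfGalois.dualAction (HopfGalois.inflate F α₂.conjAction)),
        HopfGalois.GSetIso
          (HopfGalois.dualAction (HopfGalois.inflate F α₁.betaBar))
          (HopfGalois.dualAction (HopfGalois.inflate F α₂.betaBar)),
        HopfGalois.GSetIso
          (HopfGalois.toGSet (HopfGalois.inflate F α₁.conjAction))
          (HopfGalois.toGSet (HopfGalois.inflate F α₂.conjAction)),
        HopfGalois.GSetIso
          (HopfGalois.toGSet (HopfGalois.inflate F α₁.betaBar))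
          (HopfGalois.toGSet (HopfGalois.inflate F α₂.betaBar))] := by
  obtain ⟨ζ, hζ⟩ := hζ
  have hN : Finite N := Finite.of_equiv _ α₁.evalEquiv.symm
  have hζE : IsPrimitiveRoot (algebraMap K E ζ) (Nat.card N) :=
    hζ.map_of_injective (algebraMap K E).injective
  have hsurj : Function.Surjective (algebraMap E F) :=
    HopfGalois.algebraMap_surjective_of_isCyclotomicExtension (n := Monoid.exponent N)
      (by rwa [IsCyclic.exponent_eq_card])
  -- Normality of `F` makes restriction Γ → G surjective, so Γ-sets and G-sets can be compared.
  have hnormal : Normal K F := Normal.of_algEquiv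
    (AlgEquiv.ofBijective (IsScalarTower.toAlgHom K E F) ⟨(algebraMap E F).injective, hsurj⟩)
  have hres := AlgEquiv.restrictNormalHom_surjective (F := K) (K₁ := E) F
  have hequiv (α : HopfGalois.RegularEmbedding L N) (γ : F ≃ₐ[K] F) (η : N) :=
    α.conjAction_ofInjective (AlgEquiv.restrictNormalHom E γ) η
  have hcard (α : HopfGalois.RegularEmbedding L N) : Nat.card α.image = Nat.card N :=
    (Nat.card_congr (MonoidHom.ofInjective α.injective).toEquiv).symm
  have hfin (α : HopfGalois.RegularEmbedding L N) : Finite α.image :=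
    Finite.of_equiv _ (MonoidHom.ofInjective α.injective).toEquiv
  have hcyc (α : HopfGalois.RegularEmbedding L N) : IsCyclic α.image :=
    isCyclic_of_surjective _ (MonoidHom.ofInjective α.injective).surjective
  have hchar (α : HopfGalois.RegularEmbedding L N) :
      Nat.card (α.image →* Eˣ) = Nat.card α.image :=
    HopfGalois.card_characters (by rwa [hcard])
  have hζ₁ : IsPrimitiveRoot ζ (Nat.card α₁.image) := by rwa [hcard]
  have h12 : Nat.card α₂.image = Nat.card α₁.image := by rw [hcard, hcard]
  tfae_have 2 ↔ 4 := HopfGalois.dualAction_iso_iff_toGSet_iso hζ₁ h12 _ _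
  tfae_have 3 ↔ 5 := HopfGalois.dualAction_iso_iff_toGSet_iso hζ rfl _ _
  tfae_have 5 ↔ 4 := HopfGalois.GSetIso.congr
    (HopfGalois.GSetIso.of_mulEquiv _ (hequiv α₁)) (HopfGalois.GSetIso.of_mulEquiv _ (hequiv α₂))
  tfae_have 1 ↔ 4 := by
    have h4 := HopfGalois.GSetIso.comp_iff (a := HopfGalois.toGSet α₁.conjAction)
      (b := HopfGalois.toGSet α₂.conjAction) hres
    refine Iff.trans ?_ ((HopfGalois.dualAction_iso_iff_toGSet_iso hζ₁ h12 _ _).trans h4.symm)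
    have : Infinite K := CharZero.infinite K
    exact ⟨fun ⟨σ⟩ => HopfGalois.iso_of_fixedAlgebra_equiv (hchar α₁) (hchar α₂) σ,
      HopfGalois.fixedAlgebra_equiv_of_iso (hchar α₁) (hchar α₂)⟩
  tfae_finish
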